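/- Let $\varepsilon(1),\varepsilon(2),\dots$ be independent random variables on a probability space with $\mathbf P(\varepsilon(i)=1)=\mathbf P(\varepsilon(i)=-1)=1/2$, and let $\xi(n)=\sum_{1\le i<j\le n}\varepsilon(i)\varepsilon(j)$. Then (i) $\displaystyle \mathbf P\Big[\limsup_{n\to\infty}\frac{\xi(n)}{n\,\log\log(n+3)}>0\Big]>0 .$ The sequence $\xi$ is of the following type. (ii) It is a martingale with respect to $F(n)=\sigma\{\varepsilon(j): j\le n\}$, and there are constants $0<C_1\le C_2<\infty$ with $C_1\le \operatorname{Var}(\xi(n))/n^2\le C_2$ for all $n\ge 2$. (iii) There are $\lambda_0\in(0,\infty]$ and an even, strongly convex, twice continuously differentiable function $\varphi:(-\lambda_0,\lambda_0)\to\mathbb R$, positive at positive arguments, with $\varphi(0)=0$, $\varphi''(0)>0$ and $\varphi(\lambda)/\lambda\to\infty$ as $\lambda\uparrow\lambda_0$, whose transform $\varphi^*(x)=\sup_{|\lambda|<\lambda_0}(\lambda x-\varphi(\lambda))$ satisfies $\varphi^*(x)\sim x$ as $x\to\infty$, and $$\max\big\{\mathbf P(\xi(n)/n>x),\ \mathbf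 P(\xi(n)/n<-x)\big\}\le e^{-\varphi^*(x)}\qquad\text{for all } n\ge1,\ x\ge0 .$$ Finally, the normalization cannot be improved: (iv) if $w(n)>0$ for all $n$ and $w(n)=o(\log\log(n+3))$ as $n\to\infty$, then $\mathbf P\big[\sup_{n\ge1}\xi(n)/(n\,w(n))=\infty\big]>0$. In particular $\mathbf P\big[\sup_{n\ge 1}\xi(n)/(n\,w(n))>u\big]$ does not tend to $0$ as $u\to\infty$. -/

import Mathlib

open MeasureTheory ProbabilityTheory Filter Topology

/-- A Rademacher sequence: independent random variables, each equal to `1` or `-1` with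
probability `1/2`. The indices start at `0`, so `ε i` is the `(i + 1)`-st term of the sequence. -/
structure IsRademacherSeq {Ω : Type*} [MeasurableSpace Ω] (ε : ℕ → Ω → ℝ) (P : Measure Ω) :
    Prop where
  measurable : ∀ i, Measurable (ε i)
  indep : iIndepFun ε P
  prob_one : ∀ i, P {ω | ε i ω = 1} = 1 / 2
  prob_neg_one : ∀ i, P {ω | ε i ω = -1} = 1 / 2

/-- The quadratic form `ξ(n)`: the sum of the products of two distinct terms among the first `n`
terms of the sequence, each unordered pair being taken once. -/
def rademacherChaos {Ω : Type*} (ε : ℕ → Ω → ℝ) (n : ℕ) (ω : Ω) : ℝ :=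
  ∑ j ∈ Finset.range n, ∑ i ∈ Finset.range j, ε i ω * ε j ω

/-- The natural filtration: `F(n)` is generated by the first `n` terms of the sequence. -/
def firstTermsFiltration {Ω : Type*} [m : MeasurableSpace Ω] (ε : ℕ → Ω → ℝ)
    (hε : ∀ i, Measurable (ε i)) : Filtration ℕ m where
  seq n := ⨆ i, ⨆ _ : i < n, MeasurableSpace.comap (ε i) inferInstance
  mono' _ _ h := iSup_mono fun _ => iSup_mono' fun hi => ⟨lt_of_lt_of_le hi h, le_rfl⟩
  le' _ := iSup_le fun i => iSup_le fun _ => (hε i).comap_le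

/-- The symmetric open interval `(-l₀, l₀)`, where `l₀` may be `∞`. -/
def symInterval (l₀ : EReal) : Set ℝ := {l | ((|l| : ℝ) : EReal) < l₀}

/-- The class `Φ`: even, strongly convex, twice continuously differentiable functions on
`(-l₀, l₀)`, `0 < l₀ ≤ ∞`, positive at positive arguments, with `φ 0 = 0`, `φ'' 0 > 0` and
`φ l / l → ∞` as `l ↑ l₀`. The values of `φ` outside `(-l₀, l₀)` play no role. -/
structure IsPhiFunction (l₀ : EReal) (φ : ℝ → ℝ) : Prop where
  pos_radius : 0 < l₀
  even : ∀ l ∈ symInterval l₀, φ (-l) = φ l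
  strong_convex : ∃ c > 0, StrongConvexOn (symInterval l₀) c φ
  pos : ∀ l ∈ symInterval l₀, 0 < l → 0 < φ l
  smooth : ContDiffOn ℝ 2 φ (symInterval l₀)
  zero : φ 0 = 0
  second_deriv_pos : 0 < deriv (deriv φ) 0
  superlinear : Tendsto (fun l : ℝ => φ l / l)
    (comap (fun l : ℝ => (l : EReal)) (𝓝[<] l₀)) atTop

/-- The Young-Fenchel transform `φ* u`, the supremum of `l * u - φ l` over `|l| < l₀`. For `φ` in
the class `Φ` the set is nonempty and bounded above, so this is a true supremum. -/
noncomputable def youngFenchel (l₀ : EReal) (φ : ℝ → ℝ) (u : ℝ) : ℝ :=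
  sSup ((fun l : ℝ => l * u - φ l) '' symInterval l₀)

/-- The tail function `U(X, x) = max (P (X > x), P (X < -x))`. -/
noncomputable def tailU {Ω : Type*} [MeasurableSpace Ω] (P : Measure Ω) (X : Ω → ℝ) (x : ℝ) : ℝ :=
  max (P.real {ω | x < X ω}) (P.real {ω | X ω < -x})

/-! Since `ε i ^ 2 = 1` almost surely, `ξ(n) = (S_n ^ 2 - n) / 2` with `S_n` the Rademacher sum, and
every claim becomes one about `S_n`.

Tails: conditioning on one sign at a time and using `cosh y ≤ exp (y ^ 2 / 2)` gives `E exp (a S_n ^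
2) ≤ (1 - 2 a n) ^ (-1/2)` (`integral_exp_mul_partialSum_sq_le`). As `ξ(n) / n ≥ -1/2`, the lower
tail only needs a second-order bound on `exp`. Both moment generating functions are at most `(1 - l
^ 2) ^ (-1/2)`, so `φ l = -log (1 - l ^ 2) / 2` on `(-1, 1)` works by Chernoff's bound; the finite
radius 1 yields `φ* x ~ x`.

Growth: this is the lower half of the law of the iterated logarithm for `S_n`, obtained without
Gaussian approximation. Cut the indices into blocks, the `k`-th made of about `log k` sub-blocks of
length `4 ^ k`. Each sub-block sum exceeds `2 ^ k / 5` with probability at least `1/24`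
(`le_measureReal_partialSum`), so all of them do with probability at least a constant over `k + 1`.
These events are independent and their probabilities have infinite sum, so infinitely many occur.
When one does, `S` grows by order `2 ^ k log k` across the block, hence `|S|` is that large at one
of its two ends; the sign is irrelevant because `ξ` involves `S ^ 2`. There `n` is at most of order
`4 ^ k log k`, so `ξ(n) / n` is at least of order `log k`, which dominates `log log n`. All this
holds almost surely, and the sharpness claim (iv) follows from the same bound. -/

/-- The sum of the terms of a sequence of random variables over a finite set of indices. -/
def partialSum {Ω : Type*} (ε : ℕ → Ω → ℝ) (s : Finset ℕ) (ω : Ω) : ℝ := ∑ i ∈ s, ε i ω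

lemma sq_sum_range_eq {x : ℕ → ℝ} (n : ℕ) :
    (∑ i ∈ Finset.range n, x i) ^ 2 =
      ∑ i ∈ Finset.range n, x i ^ 2 +
        2 * ∑ j ∈ Finset.range n, ∑ i ∈ Finset.range j, x i * x j := by
  induction n with
  | zero => simp
  | succ n ih =>
    simp only [Finset.sum_range_succ, ← Finset.sum_mul] at ih ⊢
    linear_combination ih

/-! ### Moments, exponential moments and anti-concentration of Rademacher sums. -/

namespace IsRademacherSeq

variable {Ω : Type*} [MeasurableSpace Ω] {P : Measure Ω} {ε : ℕ → Ω → ℝ}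

lemma measurable_partialSum (h : IsRademacherSeq ε P) (s : Finset ℕ) :
    Measurable (partialSum ε s) :=
  Finset.measurable_fun_sum s fun i _ => h.measurable i

variable [IsProbabilityMeasure P]

lemma ae_eq_one_or (h : IsRademacherSeq ε P) (i : ℕ) :
    ∀ᵐ ω ∂P, ε i ω = 1 ∨ ε i ω = -1 := by
  have m1 : MeasurableSet {ω | ε i ω = 1} := h.measurable i (measurableSet_singleton 1)
  have m2 : MeasurableSet {ω | ε i ω = -1} := h.measurable i (measurableSet_singleton (-1))
  have hd : Disjoint {ω | ε i ω = 1} {ω | ε i ω = -1} := by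
    rw [Set.disjoint_left]
    intro ω h1 h2
    simp only [Set.mem_ofPred_eq] at h1 h2
    linarith
  refine (mem_ae_iff_prob_eq_one (m1.union m2)).2 ?_
  rw [measure_union hd m2, h.prob_one, h.prob_neg_one, ENNReal.add_halves]

lemma ae_all_eq_one_or (h : IsRademacherSeq ε P) :
    ∀ᵐ ω ∂P, ∀ i, ε i ω = 1 ∨ ε i ω = -1 :=
  ae_all_iff.2 h.ae_eq_one_or

lemma integrable (h : IsRademacherSeq ε P) (i : ℕ) : Integrable (ε i) P := by
  refine Integrable.of_bound (h.measurable i).aestronglyMeasurable 1 ?_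
  filter_upwards [h.ae_eq_one_or i] with ω hω
  rcases hω with hω | hω <;> simp [hω]

lemma integral_eq_zero (h : IsRademacherSeq ε P) (i : ℕ) : ∫ ω, ε i ω ∂P = 0 := by
  have m1 : MeasurableSet {ω | ε i ω = 1} := h.measurable i (measurableSet_singleton 1)
  have m2 : MeasurableSet {ω | ε i ω = -1} := h.measurable i (measurableSet_singleton (-1))
  have : ε i =ᵐ[P] fun ω => {ω | ε i ω = 1}.indicator (fun _ => (1 : ℝ)) ω -
      {ω | ε i ω = -1}.indicator (fun _ => (1 : ℝ)) ω := by
    filter_upwards [h.ae_eq_one_or i] with ω hω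
    rcases hω with hω | hω <;> norm_num [Set.indicator_apply, hω]
  rw [integral_congr_ae this, integral_sub ((integrable_const 1).indicator m1)
    ((integrable_const 1).indicator m2), integral_indicator_const _ m1,
    integral_indicator_const _ m2]
  simp [Measure.real, h.prob_one, h.prob_neg_one]

lemma ae_abs_partialSum_le (h : IsRademacherSeq ε P) (s : Finset ℕ) :
    ∀ᵐ ω ∂P, |partialSum ε s ω| ≤ s.card := by
  filter_upwards [h.ae_all_eq_one_or] with ω hω
  refine (Finset.abs_sum_le_sum_abs _ _).trans ?_
  have : ∀ i ∈ s, |ε i ω| ≤ 1 := fun i _ => by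
    rcases hω i with hi | hi <;> simp [hi]
  simpa using Finset.sum_le_sum this

lemma integrable_comp_partialSum (h : IsRademacherSeq ε P) (s : Finset ℕ) {f : ℝ → ℝ}
    (hf : Continuous f) : Integrable (fun ω => f (partialSum ε s ω)) P := by
  obtain ⟨C, hC⟩ := (isCompact_Icc (a := -(s.card : ℝ)) (b := s.card)).exists_bound_of_continuousOn
    hf.continuousOn
  refine Integrable.of_bound
    (hf.measurable.comp (h.measurable_partialSum s)).aestronglyMeasurable C ?_
  filter_upwards [h.ae_abs_partialSum_le s] with ω hω
  exact hC _ (abs_le.1 hω)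

/-- Conditioning on one more sign. -/
lemma integral_comp_partialSum_insert (h : IsRademacherSeq ε P) {s : Finset ℕ} {i : ℕ}
    (hi : i ∉ s) {f : ℝ → ℝ} (hf : Continuous f) :
    ∫ ω, f (partialSum ε (insert i s) ω) ∂P =
      ∫ ω, (f (partialSum ε s ω + 1) + f (partialSum ε s ω - 1)) / 2 ∂P := by
  have hind : IndepFun (partialSum ε s) (ε i) P := by
    have := h.indep.indepFun_finsetSum_of_notMem h.measurable hi
    have e : (∑ j ∈ s, ε j) = partialSum ε s := by ext ω; simp [partialSum]
    rwa [e] at this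
  have c1 : Continuous fun x => (f (x + 1) + f (x - 1)) / 2 := by fun_prop
  have c2 : Continuous fun x => (f (x + 1) - f (x - 1)) / 2 := by fun_prop
  -- For a sign `e`, `f (x + e)` is the mean of `f (x + 1)` and `f (x - 1)` plus `e` times half
  -- their difference; the second part has mean zero by independence.
  have hz : ∫ ω, (f (partialSum ε s ω + 1) - f (partialSum ε s ω - 1)) / 2 * ε i ω ∂P = 0 := by
    have := (hind.comp c2.measurable measurable_id).integral_fun_mul_eq_mul_integral
      (c2.measurable.comp (h.measurable_partialSum s)).aestronglyMeasurable
      (h.measurable i).aestronglyMeasurable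
    simpa [h.integral_eq_zero] using this
  have hint : Integrable (fun ω => (f (partialSum ε s ω + 1) - f (partialSum ε s ω - 1)) / 2 *
      ε i ω) P := by
    refine (h.integrable_comp_partialSum s c2).mul_bdd (c := 1)
      (h.measurable i).aestronglyMeasurable ?_
    filter_upwards [h.ae_eq_one_or i] with ω hω
    rcases hω with hω | hω <;> simp [hω]
  rw [← add_zero (∫ ω, (f (partialSum ε s ω + 1) + f (partialSum ε s ω - 1)) / 2 ∂P), ← hz,
    ← integral_add (h.integrable_comp_partialSum s c1) hint]
  refine integral_congr_ae ?_
  filter_upwards [h.ae_eq_one_or i] with ω hω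
  simp only [partialSum, Finset.sum_insert hi]
  rcases hω with hω | hω
  · rw [hω, add_comm]; ring
  · rw [hω, add_comm, ← sub_eq_add_neg]; ring

lemma integral_partialSum (h : IsRademacherSeq ε P) (s : Finset ℕ) :
    ∫ ω, partialSum ε s ω ∂P = 0 := by
  induction s using Finset.induction_on with
  | empty => simp [partialSum]
  | insert i s hi ih =>
    rw [h.integral_comp_partialSum_insert hi (f := fun x => x) continuous_id, ← ih]
    exact integral_congr_ae (.of_forall fun ω => by ring)

lemma integral_partialSum_sq (h : IsRademacherSeq ε P) (s : Finset ℕ) :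
    ∫ ω, partialSum ε s ω ^ 2 ∂P = s.card := by
  induction s using Finset.induction_on with
  | empty => simp [partialSum]
  | insert i s hi ih =>
    rw [h.integral_comp_partialSum_insert hi (f := fun x => x ^ 2) (by fun_prop),
      Finset.card_insert_of_notMem hi]
    have : ∀ ω, ((partialSum ε s ω + 1) ^ 2 + (partialSum ε s ω - 1) ^ 2) / 2 =
      partialSum ε s ω ^ 2 + 1 := fun ω => by ring
    simp only [this]
    rw [integral_add (h.integrable_comp_partialSum s (f := fun x => x ^ 2) (by fun_prop))
      (integrable_const _), ih]
    simp

lemma integral_partialSum_cube (h : IsRademacherSeq ε P) (s : Finset ℕ) :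
    ∫ ω, partialSum ε s ω ^ 3 ∂P = 0 := by
  induction s using Finset.induction_on with
  | empty => simp [partialSum]
  | insert i s hi ih =>
    rw [h.integral_comp_partialSum_insert hi (f := fun x => x ^ 3) (by fun_prop)]
    have : ∀ ω, ((partialSum ε s ω + 1) ^ 3 + (partialSum ε s ω - 1) ^ 3) / 2 =
      partialSum ε s ω ^ 3 + 3 * partialSum ε s ω := fun ω => by ring
    simp only [this]
    rw [integral_add (h.integrable_comp_partialSum s (f := fun x => x ^ 3) (by fun_prop))
      (h.integrable_comp_partialSum s (f := fun x => 3 * x) (by fun_prop)), ih,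
      integral_const_mul, h.integral_partialSum]
    simp

lemma integral_partialSum_pow_four (h : IsRademacherSeq ε P) (s : Finset ℕ) :
    ∫ ω, partialSum ε s ω ^ 4 ∂P = 3 * (s.card : ℝ) ^ 2 - 2 * s.card := by
  induction s using Finset.induction_on with
  | empty => simp [partialSum]
  | insert i s hi ih =>
    rw [h.integral_comp_partialSum_insert hi (f := fun x => x ^ 4) (by fun_prop),
      Finset.card_insert_of_notMem hi]
    have : ∀ ω, ((partialSum ε s ω + 1) ^ 4 + (partialSum ε s ω - 1) ^ 4) / 2 =
      partialSum ε s ω ^ 4 + (6 * partialSum ε s ω ^ 2 + 1) := fun ω => by ring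
    simp only [this]
    rw [integral_add (h.integrable_comp_partialSum s (f := fun x => x ^ 4) (by fun_prop))
      (h.integrable_comp_partialSum s (f := fun x => 6 * x ^ 2 + 1) (by fun_prop)), ih,
      integral_add (h.integrable_comp_partialSum s (f := fun x => 6 * x ^ 2) (by fun_prop))
      (integrable_const _), integral_const_mul, h.integral_partialSum_sq]
    simp
    ring

/-- The squares of Rademacher sums have exponential moments at most those of the square of a
Gaussian variable with the same variance. -/
lemma integral_exp_mul_partialSum_sq_le (h : IsRademacherSeq ε P) (s : Finset ℕ) {a : ℝ}
    (ha : 0 ≤ a) (has : 2 * a * s.card < 1) :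
    (∫ ω, Real.exp (a * partialSum ε s ω ^ 2) ∂P) ^ 2 * (1 - 2 * a * s.card) ≤ 1 := by
  -- `a` must vary: removing one sign replaces it by `a + 2 * a ^ 2`.
  induction s using Finset.induction_on generalizing a with
  | empty => simp [partialSum]
  | insert i s hi ih =>
    rw [Finset.card_insert_of_notMem hi] at has ⊢
    push_cast at has ⊢
    set c : ℝ := (s.card : ℝ)
    have hc : 0 ≤ c := Nat.cast_nonneg _
    have ha2 : 0 < 1 - 2 * a := by nlinarith
    have e1 : (1 - 2 * a) * Real.exp (2 * a) ≤ 1 := by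
      have h1 : 1 - 2 * a ≤ Real.exp (-(2 * a)) := by linarith [Real.add_one_le_exp (-(2 * a))]
      calc (1 - 2 * a) * Real.exp (2 * a) ≤ Real.exp (-(2 * a)) * Real.exp (2 * a) := by gcongr
        _ = 1 := by rw [← Real.exp_add]; simp
    have e2 : 1 + 2 * a ≤ Real.exp (2 * a) := by linarith [Real.add_one_le_exp (2 * a)]
    -- The bound is preserved when `a` changes: `exp (2 a) (1 - 2 a) ≤ 1`, and `exp (2 a) ≥ 1 + 2 a`
    -- in the term with `c`.
    have key : Real.exp (2 * a) * (1 - 2 * a * (c + 1)) ≤ 1 - 2 * (a + 2 * a ^ 2) * c := by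
      have : 0 ≤ 2 * a * c * (Real.exp (2 * a) - (1 + 2 * a)) :=
        mul_nonneg (by positivity) (by linarith)
      nlinarith
    have hpos : 0 < 1 - 2 * (a + 2 * a ^ 2) * c :=
      lt_of_lt_of_le (mul_pos (Real.exp_pos _) (by linarith)) key
    have step : ∫ ω, Real.exp (a * partialSum ε (insert i s) ω ^ 2) ∂P ≤
        Real.exp a * ∫ ω, Real.exp ((a + 2 * a ^ 2) * partialSum ε s ω ^ 2) ∂P := by
      rw [h.integral_comp_partialSum_insert hi (f := fun x => Real.exp (a * x ^ 2))
        (by fun_prop), ← integral_const_mul]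
      refine integral_mono
        (h.integrable_comp_partialSum s
          (f := fun x => (Real.exp (a * (x + 1) ^ 2) + Real.exp (a * (x - 1) ^ 2)) / 2)
          (by fun_prop))
        (h.integrable_comp_partialSum s
          (f := fun x => Real.exp a * Real.exp ((a + 2 * a ^ 2) * x ^ 2)) (by fun_prop))
        fun ω => ?_
      set x := partialSum ε s ω
      have hx : (Real.exp (a * (x + 1) ^ 2) + Real.exp (a * (x - 1) ^ 2)) / 2 =
          Real.exp (a * x ^ 2 + a) * Real.cosh (2 * a * x) := by
        rw [Real.cosh_eq, mul_div_assoc', mul_add, ← Real.exp_add, ← Real.exp_add]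
        ring_nf
      simp only [hx]
      refine (mul_le_mul_of_nonneg_left (Real.cosh_le_exp_half_sq _) (Real.exp_pos _).le).trans ?_
      rw [← Real.exp_add, ← Real.exp_add]
      exact (congrArg Real.exp (by ring)).le
    set I := ∫ ω, Real.exp ((a + 2 * a ^ 2) * partialSum ε s ω ^ 2) ∂P
    have hI := ih (a := a + 2 * a ^ 2) (by positivity) (by linarith)
    have h0 : 0 ≤ ∫ ω, Real.exp (a * partialSum ε (insert i s) ω ^ 2) ∂P :=
      integral_nonneg fun ω => (Real.exp_pos _).le
    calc _ ≤ (Real.exp a * I) ^ 2 * (1 - 2 * a * (c + 1)) := by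
          have := pow_le_pow_left₀ h0 step 2
          exact mul_le_mul_of_nonneg_right this (by linarith)
      _ = I ^ 2 * (Real.exp (2 * a) * (1 - 2 * a * (c + 1))) := by
          rw [mul_pow, ← Real.exp_nat_mul]; push_cast; ring
      _ ≤ I ^ 2 * (1 - 2 * (a + 2 * a ^ 2) * c) := by gcongr
      _ ≤ 1 := hI

/-- A Rademacher sum exceeds a fixed fraction of its standard deviation with a probability
bounded away from zero. -/
lemma le_measureReal_partialSum (h : IsRademacherSeq ε P) {s : Finset ℕ} {r : ℝ} (hr : 0 < r)
    (hs : (s.card : ℝ) = r ^ 2) :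
    1 / 24 ≤ P.real {ω | r / 5 < partialSum ε s ω} := by
  -- With `y = x / r`, `q = -y ^ 4 + y ^ 3 + 5 y ^ 2 + 3 y - 1`. It is at most 0 for `y ≤ 1/5` and
  -- at most 24 everywhere, while the first four moments give mean `1 + 2 / r ^ 2`; so 24 times the
  -- probability is at least 1.
  set q : ℝ → ℝ := fun x => (x / r) * (x / r + 1) ^ 2 * (3 - x / r) - 1
  have hq : Continuous q := by fun_prop
  have mS : MeasurableSet {ω | r / 5 < partialSum ε s ω} :=
    measurableSet_lt measurable_const (h.measurable_partialSum s)
  have hle : ∀ ω, q (partialSum ε s ω) ≤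
      {ω | r / 5 < partialSum ε s ω}.indicator (fun _ => (24 : ℝ)) ω := by
    intro ω
    simp only [Set.indicator_apply, Set.mem_ofPred_eq, q]
    have hy : r / 5 < partialSum ε s ω ↔ 1 / 5 < partialSum ε s ω / r := by
      rw [lt_div_iff₀ hr]; constructor <;> intro h <;> linarith
    simp only [hy]
    generalize partialSum ε s ω / r = y
    split_ifs with h1
    · nlinarith [sq_nonneg (y ^ 2 - y - 2), sq_nonneg (y - 2), sq_nonneg (y ^ 2 - y / 2 - 3),
        sq_nonneg (y ^ 2 - y / 2 - 4)]
    · push Not at h1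
      rcases le_total y 0 with h0 | h0
      · have : y * (y + 1) ^ 2 * (3 - y) ≤ 0 :=
          mul_nonpos_of_nonpos_of_nonneg
            (mul_nonpos_of_nonpos_of_nonneg h0 (sq_nonneg _)) (by linarith)
        linarith
      · have a1 : (y + 1) ^ 2 ≤ 36 / 25 := by nlinarith
        have a2 : y * (3 - y) ≤ 14 / 25 := by nlinarith
        have a3 : 0 ≤ y * (3 - y) := mul_nonneg h0 (by linarith)
        nlinarith [mul_le_mul a2 a1 (sq_nonneg _) (by norm_num)]
  have hI := integral_mono (h.integrable_comp_partialSum s hq)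
    ((integrable_const (24 : ℝ)).indicator mS) hle
  rw [integral_indicator_const _ mS, smul_eq_mul] at hI
  have hval : (1 : ℝ) ≤ ∫ ω, q (partialSum ε s ω) ∂P := by
    have e : ∀ ω, q (partialSum ε s ω) =
        (-(r ^ 4)⁻¹ * partialSum ε s ω ^ 4 + (r ^ 3)⁻¹ * partialSum ε s ω ^ 3) +
          (5 * (r ^ 2)⁻¹ * partialSum ε s ω ^ 2 + 3 * r⁻¹ * partialSum ε s ω) - 1 := by
      intro ω
      simp only [q]
      field_simp
      ring
    simp only [e]
    have i4 := h.integrable_comp_partialSum s (f := fun x => -(r ^ 4)⁻¹ * x ^ 4) (by fun_prop)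
    have i3 := h.integrable_comp_partialSum s (f := fun x => (r ^ 3)⁻¹ * x ^ 3) (by fun_prop)
    have i2 := h.integrable_comp_partialSum s (f := fun x => 5 * (r ^ 2)⁻¹ * x ^ 2)
      (by fun_prop)
    have i1 := h.integrable_comp_partialSum s (f := fun x => 3 * r⁻¹ * x) (by fun_prop)
    have i43 : Integrable (fun ω => -(r ^ 4)⁻¹ * partialSum ε s ω ^ 4 +
      (r ^ 3)⁻¹ * partialSum ε s ω ^ 3) P := i4.add i3
    have i21 : Integrable (fun ω => 5 * (r ^ 2)⁻¹ * partialSum ε s ω ^ 2 +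
      3 * r⁻¹ * partialSum ε s ω) P := i2.add i1
    rw [integral_sub (by exact i43.add i21) (integrable_const _),
      integral_add i43 i21, integral_add i4 i3, integral_add i2 i1,
      integral_const_mul, integral_const_mul, integral_const_mul, integral_const_mul,
      h.integral_partialSum, h.integral_partialSum_sq, h.integral_partialSum_cube,
      h.integral_partialSum_pow_four, hs]
    have e2 : -(r ^ 4)⁻¹ * (3 * (r ^ 2) ^ 2 - 2 * r ^ 2) + (r ^ 3)⁻¹ * 0 +
        (5 * (r ^ 2)⁻¹ * r ^ 2 + 3 * r⁻¹ * 0) = 2 + 2 * (r ^ 2)⁻¹ := by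
      field_simp
      ring
    rw [e2]
    have : 0 < (r ^ 2)⁻¹ := by positivity
    simp
    linarith
  linarith

end IsRademacherSeq

/-! ### The function `-log (1 - l ^ 2) / 2` and its Young-Fenchel transform. -/

/-- The function `-log (1 - l ^ 2) / 2` on `(-1, 1)`. -/
noncomputable def halfNegLog (l : ℝ) : ℝ := -(1 / 2) * Real.log (1 - l ^ 2)

lemma symInterval_one : symInterval 1 = Set.Ioo (-1) 1 := by
  ext l
  rw [symInterval, Set.mem_ofPred_eq, ← EReal.coe_one, EReal.coe_lt_coe_iff, abs_lt, Set.mem_Ioo]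

lemma one_sub_sq_pos {l : ℝ} (hl : l ∈ Set.Ioo (-1 : ℝ) 1) : 0 < 1 - l ^ 2 := by
  nlinarith [hl.1, hl.2]

lemma halfNegLog_nonneg {l : ℝ} (hl : l ∈ Set.Ioo (-1 : ℝ) 1) : 0 ≤ halfNegLog l := by
  have := Real.log_nonpos (one_sub_sq_pos hl).le (by nlinarith [sq_nonneg l])
  unfold halfNegLog
  linarith

lemma hasDerivAt_halfNegLog {l : ℝ} (hl : l ∈ Set.Ioo (-1 : ℝ) 1) :
    HasDerivAt halfNegLog (l / (1 - l ^ 2)) l := by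
  have h0 := one_sub_sq_pos hl
  have h1 : HasDerivAt (fun x : ℝ => 1 - x ^ 2) (-(2 * l)) l := by
    simpa using (hasDerivAt_pow 2 l).const_sub 1
  convert! (h1.log h0.ne').const_mul (-(1 / 2) : ℝ) using 1
  field_simp

lemma hasDerivAt_deriv_halfNegLog {l : ℝ} (hl : l ∈ Set.Ioo (-1 : ℝ) 1) :
    HasDerivAt (deriv halfNegLog) ((1 + l ^ 2) / (1 - l ^ 2) ^ 2) l := by
  have h0 := one_sub_sq_pos hl
  have h1 : HasDerivAt (fun x : ℝ => 1 - x ^ 2) (-(2 * l)) l := by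
    simpa using (hasDerivAt_pow 2 l).const_sub 1
  have h2 : HasDerivAt (fun x : ℝ => x / (1 - x ^ 2)) ((1 + l ^ 2) / (1 - l ^ 2) ^ 2) l := by
    convert! (hasDerivAt_id l).div h1 h0.ne' using 1
    simp only [id]
    ring
  refine h2.congr_of_eventuallyEq ?_
  filter_upwards [isOpen_Ioo.mem_nhds hl] with x hx using (hasDerivAt_halfNegLog hx).deriv

/-- The second derivative `(1 + l ^ 2) / (1 - l ^ 2) ^ 2` is at least 1, so subtracting `l ^ 2 / 2`
leaves a convex function. -/
lemma strongConvexOn_halfNegLog : StrongConvexOn (Set.Ioo (-1 : ℝ) 1) 1 halfNegLog := by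
  rw [strongConvexOn_iff_convex]
  have e : (fun x : ℝ => halfNegLog x - 1 / 2 * ‖x‖ ^ 2) =
      fun x => halfNegLog x - 1 / 2 * x ^ 2 := by
    ext x; simp
  rw [e]
  have hd : ∀ x ∈ Set.Ioo (-1 : ℝ) 1,
      HasDerivAt (fun x => halfNegLog x - 1 / 2 * x ^ 2) (x / (1 - x ^ 2) - x) x := by
    intro x hx
    convert! (hasDerivAt_halfNegLog hx).sub ((hasDerivAt_pow 2 x).const_mul (1 / 2 : ℝ)) using 1
    simp
  have hd2 : ∀ x ∈ Set.Ioo (-1 : ℝ) 1,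
      HasDerivAt (deriv fun x => halfNegLog x - 1 / 2 * x ^ 2)
        ((1 + x ^ 2) / (1 - x ^ 2) ^ 2 - 1) x := by
    intro x hx
    refine ((hasDerivAt_deriv_halfNegLog hx).sub (hasDerivAt_id x)).congr_of_eventuallyEq ?_
    filter_upwards [isOpen_Ioo.mem_nhds hx] with y hy
    rw [(hd y hy).deriv]
    simp [(hasDerivAt_halfNegLog hy).deriv]
  refine convexOn_of_deriv2_nonneg (convex_Ioo _ _)
    (fun x hx => (hd x hx).continuousAt.continuousWithinAt) ?_ ?_ ?_ <;>
    rw [interior_Ioo]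
  · exact fun x hx => (hd x hx).differentiableAt.differentiableWithinAt
  · exact fun x hx => (hd2 x hx).differentiableAt.differentiableWithinAt
  · intro x hx
    have h0 := one_sub_sq_pos hx
    simp only [Function.iterate_succ, Function.iterate_zero, Function.comp_apply, id]
    rw [(hd2 x hx).deriv, sub_nonneg, one_le_div (by positivity)]
    nlinarith [sq_nonneg x]

lemma comap_coe_nhdsLT_one :
    comap (fun l : ℝ => (l : EReal)) (𝓝[<] (1 : EReal)) = 𝓝[<] (1 : ℝ) := by
  have h : (fun l : ℝ => (l : EReal)) ⁻¹' Set.Iio 1 = Set.Iio 1 := by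
    ext l
    rw [Set.mem_preimage, Set.mem_Iio, Set.mem_Iio, ← EReal.coe_one, EReal.coe_lt_coe_iff]
  rw [nhdsWithin, nhdsWithin, comap_inf, comap_principal, h, ← EReal.coe_one,
    EReal.isEmbedding_coe.nhds_eq_comap]

lemma tendsto_halfNegLog_div : Tendsto (fun l : ℝ => halfNegLog l / l) (𝓝[<] 1) atTop := by
  have h1 : Tendsto (fun l : ℝ => 1 - l ^ 2) (𝓝[<] 1) (𝓝[>] 0) := by
    refine tendsto_nhdsWithin_iff.2 ⟨?_, ?_⟩
    · have : Tendsto (fun l : ℝ => 1 - l ^ 2) (𝓝 1) (𝓝 (1 - 1 ^ 2)) :=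
        Continuous.tendsto (by fun_prop) 1
      rw [one_pow, sub_self] at this
      exact this.mono_left nhdsWithin_le_nhds
    · filter_upwards [Ioo_mem_nhdsLT (show (-1 : ℝ) < 1 by norm_num)] with l hl
      exact one_sub_sq_pos hl
  have h2 : Tendsto halfNegLog (𝓝[<] 1) atTop :=
    (Real.tendsto_log_nhdsGT_zero.comp h1).const_mul_atBot_of_neg (by norm_num)
  refine tendsto_atTop_mono' _ ?_ h2
  filter_upwards [Ioo_mem_nhdsLT (show (0 : ℝ) < 1 by norm_num)] with l hl
  rw [le_div_iff₀ hl.1]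
  exact mul_le_of_le_one_right (halfNegLog_nonneg ⟨by linarith [hl.1], hl.2⟩) hl.2.le

lemma isPhiFunction_halfNegLog : IsPhiFunction 1 halfNegLog where
  pos_radius := zero_lt_one
  even l _ := by simp [halfNegLog]
  strong_convex := ⟨1, one_pos, symInterval_one ▸ strongConvexOn_halfNegLog⟩
  pos l hl h0 := by
    rw [symInterval_one] at hl
    have := Real.log_neg (one_sub_sq_pos hl) (by nlinarith)
    unfold halfNegLog
    linarith
  smooth := by
    rw [symInterval_one]
    refine contDiffOn_const.mul (ContDiffOn.log (by fun_prop) fun l hl => ?_)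
    exact (one_sub_sq_pos hl).ne'
  zero := by simp [halfNegLog]
  second_deriv_pos := by
    rw [(hasDerivAt_deriv_halfNegLog (l := 0) (by norm_num)).deriv]
    norm_num
  superlinear := by
    rw [comap_coe_nhdsLT_one]
    exact tendsto_halfNegLog_div

lemma youngFenchel_halfNegLog_le {x b : ℝ}
    (h : ∀ l ∈ Set.Ioo (-1 : ℝ) 1, l * x - halfNegLog l ≤ b) :
    youngFenchel 1 halfNegLog x ≤ b := by
  rw [youngFenchel, symInterval_one]
  refine csSup_le (Set.Nonempty.image _ ⟨0, by norm_num⟩) ?_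
  rintro _ ⟨l, hl, rfl⟩
  exact h l hl

lemma mul_sub_halfNegLog_le {x l : ℝ} (hx : 0 ≤ x) (hl : l ∈ Set.Ioo (-1 : ℝ) 1) :
    l * x - halfNegLog l ≤ x := by
  nlinarith [halfNegLog_nonneg hl, hl.2]

lemma le_youngFenchel_halfNegLog {x l : ℝ} (hx : 0 ≤ x) (hl : l ∈ Set.Ioo (-1 : ℝ) 1) :
    l * x - halfNegLog l ≤ youngFenchel 1 halfNegLog x := by
  rw [youngFenchel, symInterval_one]
  refine le_csSup ⟨x, ?_⟩ ⟨l, hl, rfl⟩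
  rintro _ ⟨l, hl, rfl⟩
  exact mul_sub_halfNegLog_le hx hl

/-- Above, `φ ≥ 0` and `l < 1` give `φ* x ≤ x`. Below, each fixed `l < 1` gives `φ* x ≥ l x - φ l`,
of slope `l` arbitrarily close to 1. -/
lemma tendsto_youngFenchel_halfNegLog_div :
    Tendsto (fun x : ℝ => youngFenchel 1 halfNegLog x / x) atTop (𝓝 1) := by
  refine tendsto_order.2 ⟨fun a ha => ?_, fun a ha => ?_⟩
  · obtain ⟨l, hl1, hl2⟩ := exists_between (max_lt ha (show (0 : ℝ) < 1 by norm_num))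
    have hal : a < l := (le_max_left _ _).trans_lt hl1
    have hl : l ∈ Set.Ioo (-1 : ℝ) 1 :=
      ⟨by linarith [(le_max_right a 0).trans_lt hl1], hl2⟩
    filter_upwards [eventually_gt_atTop (halfNegLog l / (l - a)), eventually_gt_atTop 0]
      with x hx hx0
    rw [lt_div_iff₀ hx0]
    rw [div_lt_iff₀ (by linarith)] at hx
    linarith [le_youngFenchel_halfNegLog hx0.le hl]
  · filter_upwards [eventually_gt_atTop 0] with x hx0
    refine lt_of_le_of_lt ?_ ha
    rw [div_le_one hx0]
    exact youngFenchel_halfNegLog_le fun l hl => mul_sub_halfNegLog_le hx0.le hl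

lemma le_exp_halfNegLog {M l : ℝ} (hl : l ∈ Set.Ioo (-1 : ℝ) 1)
    (h : M ^ 2 * (1 - l ^ 2) ≤ 1) : M ≤ Real.exp (halfNegLog l) := by
  have h0 := one_sub_sq_pos hl
  refine le_of_sq_le_sq ?_ (Real.exp_pos _).le
  have : Real.exp (halfNegLog l) ^ 2 = (1 - l ^ 2)⁻¹ := by
    rw [← Real.exp_nat_mul, ← Real.exp_log (inv_pos.2 h0), Real.log_inv]
    congr 1
    unfold halfNegLog
    push_cast
    ring
  rw [this, ← one_div, le_div_iff₀ h0]
  exact h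

/-! ### The chaos: martingale property, variance and tails. -/

namespace IsRademacherSeq

variable {Ω : Type*} [MeasurableSpace Ω] {P : Measure Ω} {ε : ℕ → Ω → ℝ}

lemma measurable_rademacherChaos (h : IsRademacherSeq ε P) (n : ℕ) :
    Measurable (rademacherChaos ε n) :=
  Finset.measurable_fun_sum _ fun j _ => Finset.measurable_fun_sum _ fun i _ =>
    (h.measurable i).mul (h.measurable j)

lemma stronglyMeasurable_firstTermsFiltration (h : IsRademacherSeq ε P) {i n : ℕ} (hi : i < n) :
    StronglyMeasurable[firstTermsFiltration ε h.measurable n] (ε i) := by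
  have h1 : Measurable[MeasurableSpace.comap (ε i) inferInstance] (ε i) :=
    comap_measurable (ε i)
  have h2 : MeasurableSpace.comap (ε i) inferInstance ≤ firstTermsFiltration ε h.measurable n :=
    le_iSup₂_of_le (f := fun i (_ : i < n) => MeasurableSpace.comap (ε i) inferInstance) i hi le_rfl
  exact (h1.mono h2 le_rfl).stronglyMeasurable

variable [IsProbabilityMeasure P]

lemma ae_rademacherChaos_eq (h : IsRademacherSeq ε P) :
    ∀ᵐ ω ∂P, ∀ n, rademacherChaos ε n ω = (partialSum ε (Finset.range n) ω ^ 2 - n) / 2 := by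
  filter_upwards [h.ae_all_eq_one_or] with ω hω n
  have h1 : ∑ i ∈ Finset.range n, ε i ω ^ 2 = n := by
    have : ∀ i ∈ Finset.range n, ε i ω ^ 2 = 1 := fun i _ => by
      rcases hω i with hi | hi <;> simp [hi]
    simp [Finset.sum_congr rfl this]
  have := sq_sum_range_eq (x := fun i => ε i ω) n
  rw [h1] at this
  unfold rademacherChaos partialSum
  linarith

lemma rademacherChaos_ae_eq (h : IsRademacherSeq ε P) (n : ℕ) :
    rademacherChaos ε n =ᵐ[P] fun ω => (partialSum ε (Finset.range n) ω ^ 2 - n) / 2 :=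
  h.ae_rademacherChaos_eq.mono fun _ hω => hω n

lemma integral_rademacherChaos (h : IsRademacherSeq ε P) (n : ℕ) :
    ∫ ω, rademacherChaos ε n ω ∂P = 0 := by
  rw [integral_congr_ae (h.rademacherChaos_ae_eq n), integral_div, integral_sub
    (h.integrable_comp_partialSum _ (f := fun x => x ^ 2) (by fun_prop)) (integrable_const _),
    h.integral_partialSum_sq]
  simp

lemma integral_rademacherChaos_sq (h : IsRademacherSeq ε P) (n : ℕ) :
    ∫ ω, rademacherChaos ε n ω ^ 2 ∂P = (n : ℝ) * (n - 1) / 2 := by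
  have : (fun ω => rademacherChaos ε n ω ^ 2) =ᵐ[P]
      fun ω => (1 / 4) * partialSum ε (Finset.range n) ω ^ 4 +
        (-(n / 2) * partialSum ε (Finset.range n) ω ^ 2 + n ^ 2 / 4) := by
    filter_upwards [h.rademacherChaos_ae_eq n] with ω hω
    rw [hω]
    ring
  rw [integral_congr_ae this, integral_add
    (h.integrable_comp_partialSum _ (f := fun x => 1 / 4 * x ^ 4) (by fun_prop))
    (h.integrable_comp_partialSum _ (f := fun x => -(n / 2) * x ^ 2 + n ^ 2 / 4) (by fun_prop)),
    integral_add (h.integrable_comp_partialSum _ (f := fun x => -(n / 2) * x ^ 2) (by fun_prop))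
    (integrable_const _), integral_const_mul, integral_const_mul, h.integral_partialSum_sq,
    h.integral_partialSum_pow_four]
  simp
  ring

lemma variance_rademacherChaos (h : IsRademacherSeq ε P) (n : ℕ) :
    Var[rademacherChaos ε n; P] = (n : ℝ) * (n - 1) / 2 := by
  rw [variance_of_integral_eq_zero (h.measurable_rademacherChaos n).aemeasurable
    (h.integral_rademacherChaos n), h.integral_rademacherChaos_sq]

lemma variance_rademacherChaos_div_bounds (h : IsRademacherSeq ε P) {n : ℕ} (hn : 2 ≤ n) :
    1 / 4 ≤ Var[rademacherChaos ε n; P] / (n : ℝ) ^ 2 ∧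
      Var[rademacherChaos ε n; P] / (n : ℝ) ^ 2 ≤ 1 / 2 := by
  have hn' : (2 : ℝ) ≤ n := by exact_mod_cast hn
  rw [h.variance_rademacherChaos, le_div_iff₀ (by positivity), div_le_iff₀ (by positivity)]
  constructor <;> nlinarith

lemma integrable_rademacherChaos (h : IsRademacherSeq ε P) (n : ℕ) :
    Integrable (rademacherChaos ε n) P :=
  (h.integrable_comp_partialSum (Finset.range n) (f := fun x => (x ^ 2 - n) / 2)
    (by fun_prop)).congr (h.rademacherChaos_ae_eq n).symm

/-- The increment is `S_n * ε n`: a factor known at time `n` times a centred sign independent of the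
past. -/
lemma martingale_rademacherChaos (h : IsRademacherSeq ε P) :
    Martingale (rademacherChaos ε) (firstTermsFiltration ε h.measurable) P := by
  refine martingale_of_condExp_sub_eq_zero_nat (fun n => ?_) h.integrable_rademacherChaos
    fun n => ?_
  · refine Finset.stronglyMeasurable_fun_sum _ fun j hj =>
      Finset.stronglyMeasurable_fun_sum _ fun i hi => ?_
    rw [Finset.mem_range] at hj hi
    exact (h.stronglyMeasurable_firstTermsFiltration (hi.trans hj)).mul
      (h.stronglyMeasurable_firstTermsFiltration hj)
  · have e : rademacherChaos ε (n + 1) - rademacherChaos ε n =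
        partialSum ε (Finset.range n) * ε n := by
      ext ω
      simp [rademacherChaos, partialSum, Finset.sum_range_succ, Finset.sum_mul]
    have hS : StronglyMeasurable[firstTermsFiltration ε h.measurable n]
        (partialSum ε (Finset.range n)) :=
      Finset.stronglyMeasurable_fun_sum _ fun i hi =>
        h.stronglyMeasurable_firstTermsFiltration (Finset.mem_range.1 hi)
    have hind : Indep (MeasurableSpace.comap (ε n) inferInstance)
        (firstTermsFiltration ε h.measurable n) P := by
      have := indep_iSup_of_disjoint (fun i => (h.measurable i).comap_le) h.indep.iIndep
        (S := {n}) (T := {i | i < n}) (by simp)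
      simpa using! this
    have h0 : P[ε n | firstTermsFiltration ε h.measurable n] =ᵐ[P] fun _ => ∫ ω, ε n ω ∂P :=
      condExp_indep_eq (h.measurable n).comap_le
        ((firstTermsFiltration ε h.measurable).le n)
        (comap_measurable (ε n)).stronglyMeasurable hind
    rw [e]
    refine (condExp_mul_of_stronglyMeasurable_left hS ?_ (h.integrable n)).trans ?_
    · rw [← e]
      exact (h.integrable_rademacherChaos _).sub (h.integrable_rademacherChaos _)
    · filter_upwards [h0] with ω hω
      simp [hω, h.integral_eq_zero]

lemma mgf_rademacherChaos_div_le (h : IsRademacherSeq ε P) {n : ℕ} (hn : 1 ≤ n) {l : ℝ}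
    (h0 : 0 ≤ l) (h1 : l < 1) :
    mgf (fun ω => rademacherChaos ε n ω / n) P l ≤ Real.exp (halfNegLog l) := by
  have hn' : (0 : ℝ) < n := by exact_mod_cast hn
  refine le_exp_halfNegLog ⟨by linarith, h1⟩ ?_
  set I := ∫ ω, Real.exp (l / (2 * n) * partialSum ε (Finset.range n) ω ^ 2) ∂P
  have hI : I ^ 2 * (1 - l) ≤ 1 := by
    have e : 2 * (l / (2 * n)) * ((Finset.range n).card : ℝ) = l := by
      rw [Finset.card_range]; field_simp
    have := h.integral_exp_mul_partialSum_sq_le (Finset.range n) (a := l / (2 * n))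
      (by positivity) (by rw [e]; exact h1)
    rwa [e] at this
  have hm : mgf (fun ω => rademacherChaos ε n ω / n) P l = Real.exp (-(l / 2)) * I := by
    rw [mgf, ← integral_const_mul]
    refine integral_congr_ae ?_
    filter_upwards [h.rademacherChaos_ae_eq n] with ω hω
    simp only [hω]
    rw [← Real.exp_add]
    congr 1
    field_simp
    ring
  -- The centring of `ξ` contributes `exp (-l) ≤ 1 / (1 + l)`, which turns `1 / (1 - l)` into `1 /
  -- (1 - l ^ 2)`.
  have he : Real.exp (-(l / 2)) ^ 2 * (1 + l) ≤ 1 := by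
    have e2 : Real.exp (-(l / 2)) ^ 2 = Real.exp (-l) := by
      rw [← Real.exp_nat_mul]; congr 1; push_cast; ring
    have : l + 1 ≤ Real.exp l := Real.add_one_le_exp l
    calc _ ≤ Real.exp (-l) * Real.exp l := by rw [e2]; gcongr; linarith
      _ = 1 := by rw [← Real.exp_add]; simp
  rw [hm]
  calc (Real.exp (-(l / 2)) * I) ^ 2 * (1 - l ^ 2)
      = (Real.exp (-(l / 2)) ^ 2 * (1 + l)) * (I ^ 2 * (1 - l)) := by ring
    _ ≤ 1 * 1 := mul_le_mul he hI (mul_nonneg (sq_nonneg _) (by linarith)) zero_le_one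
    _ = 1 := one_mul 1

lemma mgf_neg_rademacherChaos_div_le (h : IsRademacherSeq ε P) {n : ℕ} (hn : 1 ≤ n) {l : ℝ}
    (h0 : 0 ≤ l) (h1 : l < 1) :
    mgf (fun ω => -(rademacherChaos ε n ω / n)) P l ≤ Real.exp (halfNegLog l) := by
  have hn' : (1 : ℝ) ≤ n := by exact_mod_cast hn
  refine le_exp_halfNegLog ⟨by linarith, h1⟩ ?_
  -- Valid for all `y ≤ 1`, and here `y = -l ξ(n) / n ≤ l / 2`, so no exponential moment is needed:
  -- mean zero and the variance suffice.
  have hexp : ∀ y : ℝ, y ≤ 1 → Real.exp y ≤ 1 + y + y ^ 2 := by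
    intro y hy
    rcases le_total (-1) y with h2 | h2
    · linarith [(abs_le.1 (Real.abs_exp_sub_one_sub_id_le (abs_le.2 ⟨h2, hy⟩))).2]
    · have : Real.exp y ≤ 1 := Real.exp_le_one_iff.2 (by linarith)
      nlinarith
  have hX2 : Integrable (fun ω => rademacherChaos ε n ω ^ 2) P := by
    refine (h.integrable_comp_partialSum (Finset.range n) (f := fun x => ((x ^ 2 - n) / 2) ^ 2)
      (by fun_prop)).congr ?_
    filter_upwards [h.rademacherChaos_ae_eq n] with ω hω
    rw [hω]
  have hle : mgf (fun ω => -(rademacherChaos ε n ω / n)) P l ≤ 1 + l ^ 2 / 2 := by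
    have i1 : Integrable (fun ω => -(l / n) * rademacherChaos ε n ω) P :=
      (h.integrable_rademacherChaos n).const_mul _
    have i2 : Integrable (fun ω => (l / n) ^ 2 * rademacherChaos ε n ω ^ 2) P :=
      hX2.const_mul _
    have i12 : Integrable (fun ω => -(l / n) * rademacherChaos ε n ω +
      (l / n) ^ 2 * rademacherChaos ε n ω ^ 2) P := i1.add i2
    have i012 : Integrable (fun ω => 1 + (-(l / n) * rademacherChaos ε n ω +
      (l / n) ^ 2 * rademacherChaos ε n ω ^ 2)) P := (integrable_const 1).add i12
    have hb : mgf (fun ω => -(rademacherChaos ε n ω / n)) P l ≤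
        ∫ ω, 1 + (-(l / n) * rademacherChaos ε n ω +
          (l / n) ^ 2 * rademacherChaos ε n ω ^ 2) ∂P := by
      refine integral_mono_of_nonneg (.of_forall fun ω => (Real.exp_pos _).le) i012 ?_
      filter_upwards [h.rademacherChaos_ae_eq n] with ω hω
      have hy : l * -(rademacherChaos ε n ω / n) ≤ 1 := by
        rw [hω]
        have : -(1 / 2) ≤ (partialSum ε (Finset.range n) ω ^ 2 - n) / 2 / n := by
          rw [le_div_iff₀ (by linarith)]
          nlinarith [sq_nonneg (partialSum ε (Finset.range n) ω)]
        nlinarith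
      refine (hexp _ hy).trans (le_of_eq ?_)
      ring
    refine hb.trans ?_
    rw [integral_add (integrable_const 1) i12, integral_add i1 i2, integral_const_mul,
      integral_const_mul, h.integral_rademacherChaos, h.integral_rademacherChaos_sq]
    have : (l / n) ^ 2 * ((n : ℝ) * (n - 1) / 2) = l ^ 2 / 2 * ((n - 1) / n) := by
      field_simp
    have h3 : ((n : ℝ) - 1) / n ≤ 1 := by
      rw [div_le_one (by linarith)]; linarith
    simp only [integral_const, probReal_univ, smul_eq_mul, mul_one, mul_zero, zero_add, this]
    nlinarith [sq_nonneg l]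
  have hm0 : 0 ≤ mgf (fun ω => -(rademacherChaos ε n ω / n)) P l := mgf_nonneg
  have h4 : 0 ≤ 1 - l ^ 2 := by nlinarith
  calc _ ≤ (1 + l ^ 2 / 2) ^ 2 * (1 - l ^ 2) := by gcongr
    -- With `t = l ^ 2` the left side is `1 - 3 t ^ 2 / 4 - t ^ 3 / 4`.
    _ ≤ 1 := by nlinarith [sq_nonneg l, sq_nonneg (l ^ 2),
        mul_nonneg (sq_nonneg l) (sq_nonneg (l ^ 2))]

lemma integrable_exp_mul_rademacherChaos (h : IsRademacherSeq ε P) (n : ℕ) (t : ℝ) :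
    Integrable (fun ω => Real.exp (t * rademacherChaos ε n ω)) P := by
  refine (h.integrable_comp_partialSum (Finset.range n)
    (f := fun x => Real.exp (t * ((x ^ 2 - n) / 2))) (by fun_prop)).congr ?_
  filter_upwards [h.rademacherChaos_ae_eq n] with ω hω
  rw [hω]

lemma tailU_rademacherChaos_div_le (h : IsRademacherSeq ε P) {n : ℕ} (hn : 1 ≤ n) {l x : ℝ}
    (h0 : 0 ≤ l) (h1 : l < 1) :
    tailU P (fun ω => rademacherChaos ε n ω / n) x ≤ Real.exp (-(l * x - halfNegLog l)) := by
  have e : Real.exp (-(l * x - halfNegLog l)) = Real.exp (-l * x) * Real.exp (halfNegLog l) := by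
    rw [← Real.exp_add]; congr 1; ring
  rw [e]
  refine max_le ?_ ?_
  · refine (measureReal_mono fun ω (hω : x < _) => hω.le).trans
      ((measure_ge_le_exp_mul_mgf x h0 ?_).trans (mul_le_mul_of_nonneg_left
        (h.mgf_rademacherChaos_div_le hn h0 h1) (Real.exp_pos _).le))
    convert h.integrable_exp_mul_rademacherChaos n (l / n) using 3
    ring
  · refine (measureReal_mono fun ω (hω : _ < -x) => ?_).trans
      ((measure_ge_le_exp_mul_mgf x h0 ?_).trans (mul_le_mul_of_nonneg_left
        (h.mgf_neg_rademacherChaos_div_le hn h0 h1) (Real.exp_pos _).le))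
    · exact (lt_neg_of_lt_neg hω).le
    · convert h.integrable_exp_mul_rademacherChaos n (-(l / n)) using 3
      ring

lemma tailU_rademacherChaos_div_le_exp_youngFenchel (h : IsRademacherSeq ε P) {n : ℕ}
    (hn : 1 ≤ n) {x : ℝ} (hx : 0 ≤ x) :
    tailU P (fun ω => rademacherChaos ε n ω / n) x
      ≤ Real.exp (-youngFenchel 1 halfNegLog x) := by
  set U := tailU P (fun ω => rademacherChaos ε n ω / n) x
  have hU1 : U ≤ 1 := max_le measureReal_le_one measureReal_le_one
  rcases le_or_gt U 0 with hU | hU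
  · exact hU.trans (Real.exp_pos _).le
  rw [← Real.log_le_iff_le_exp hU, le_neg]
  refine youngFenchel_halfNegLog_le fun l hl => ?_
  rcases le_or_gt 0 l with h0 | h0
  · have := h.tailU_rademacherChaos_div_le hn (x := x) h0 hl.2
    rw [← Real.log_le_iff_le_exp hU] at this
    linarith
  -- For `l < 0 ≤ x` the exponent `l x - φ l` is nonpositive and the trivial bound `U ≤ 1` suffices.
  · nlinarith [halfNegLog_nonneg hl, Real.log_nonpos hU.le hU1]

end IsRademacherSeq

/-! ### Independent blocks and their sizes. -/

/-- Events depending on pairwise disjoint blocks of independent σ-algebras are independent. -/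
lemma ProbabilityTheory.iIndep.measure_biInter_of_disjoint {Ω ι κ : Type*} [mΩ : MeasurableSpace Ω]
    {P : Measure Ω} [IsProbabilityMeasure P] {m : ι → MeasurableSpace Ω} (hm : ∀ i, m i ≤ mΩ)
    (h : iIndep m P) {B : κ → Set ι} {A : κ → Set Ω} {s : Finset κ}
    (hB : (s : Set κ).PairwiseDisjoint B)
    (hA : ∀ k ∈ s, MeasurableSet[⨆ i ∈ B k, m i] (A k)) :
    P (⋂ k ∈ s, A k) = ∏ k ∈ s, P (A k) := by
  classical
  induction s using Finset.induction_on with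
  | empty => simp
  | insert k s hk ih =>
    rw [Finset.coe_insert, Set.pairwiseDisjoint_insert_of_notMem (by exact_mod_cast hk)] at hB
    have hdisj : Disjoint (B k) (⋃ j ∈ s, B j) :=
      Set.disjoint_iUnion₂_right.2 fun j hj => hB.2 j hj
    have hs : MeasurableSet[⨆ i ∈ ⋃ j ∈ s, B j, m i] (⋂ j ∈ s, A j) := by
      refine Finset.measurableSet_biInter _ fun j hj => ?_
      have hle : ⨆ i ∈ B j, m i ≤ ⨆ i ∈ ⋃ j ∈ s, B j, m i :=
        biSup_mono fun i hi => Set.mem_biUnion hj hi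
      exact hle _ (hA j (Finset.mem_insert_of_mem hj))
    have := (Indep_iff _ _ _).1 (indep_iSup_of_disjoint hm h hdisj) _ _
      (hA k (Finset.mem_insert_self k s)) hs
    rw [Finset.set_biInter_insert, this, Finset.prod_insert hk,
      ih hB.1 fun j hj => hA j (Finset.mem_insert_of_mem hj)]

/-- The number of sub-blocks in the `k`-th block. -/
def blockRate (k : ℕ) : ℕ := Nat.log 24 (k + 1) + 1

/-- The first index of the `k`-th block, which consists of `blockRate k` sub-blocks of length
`4 ^ k`. -/
def blockStart : ℕ → ℕ
  | 0 => 0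
  | k + 1 => blockStart k + blockRate k * 4 ^ k

/-- The `j`-th sub-block of the `k`-th block. -/
def subBlock (k j : ℕ) : Finset ℕ :=
  Finset.Ico (blockStart k + j * 4 ^ k) (blockStart k + (j + 1) * 4 ^ k)

/-- The event that over all sub-blocks of the `k`-th block the sum exceeds a fifth of its
standard deviation. -/
def blockEvent {Ω : Type*} (ε : ℕ → Ω → ℝ) (k : ℕ) : Set Ω :=
  ⋂ j ∈ Finset.range (blockRate k), {ω | 2 ^ k / 5 < partialSum ε (subBlock k j) ω}

lemma one_le_blockRate (k : ℕ) : 1 ≤ blockRate k := Nat.le_add_left _ _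

lemma blockRate_mono : Monotone blockRate := fun _ _ h =>
  Nat.add_le_add_right (Nat.log_mono_right (Nat.add_le_add_right h 1)) 1

lemma eventually_le_blockRate (m : ℕ) : ∀ᶠ k in atTop, m ≤ blockRate k := by
  filter_upwards [eventually_ge_atTop (24 ^ m)] with k hk
  exact (Nat.le_log_of_pow_le (by norm_num) (hk.trans (Nat.le_succ k))).trans (Nat.le_succ _)

/-- Base 24 matches the probability `1/24` per sub-block. This bound makes `blockRate` dominate `log
log n`; `pow_blockRate_le` keeps the block probabilities non-summable. -/
lemma lt_pow_blockRate (k : ℕ) : k + 1 < 24 ^ blockRate k :=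
  Nat.lt_pow_succ_log_self (by norm_num) _

lemma pow_blockRate_le (k : ℕ) : 24 ^ blockRate k ≤ 24 * (k + 1) := by
  rw [blockRate, pow_succ, mul_comm]
  exact Nat.mul_le_mul_left _ (Nat.pow_log_le_self 24 (Nat.succ_ne_zero k))

lemma blockRate_le (k : ℕ) : blockRate k ≤ k + 2 :=
  Nat.add_le_add_right (Nat.log_le_self 24 (k + 1)) 1

lemma monotone_blockStart : Monotone blockStart :=
  monotone_nat_of_le_succ fun _ => Nat.le_add_right _ _

lemma le_blockStart (k : ℕ) : k ≤ blockStart k := by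
  induction k with
  | zero => exact Nat.zero_le _
  | succ k ih =>
    have : 1 ≤ blockRate k * 4 ^ k := Nat.mul_pos (one_le_blockRate k) (by positivity)
    rw [blockStart]
    omega

/-- Lengths grow geometrically, so all earlier blocks together are no longer than the `k`-th. -/
lemma blockStart_le (k : ℕ) : blockStart k ≤ blockRate k * 4 ^ k := by
  induction k with
  | zero => exact Nat.zero_le _
  | succ k ih =>
    have h := Nat.mul_le_mul_right (4 ^ k) (blockRate_mono (Nat.le_succ k))
    rw [blockStart, pow_succ]
    nlinarith

lemma blockStart_succ_le (k : ℕ) : blockStart (k + 1) ≤ 2 * (blockRate k * 4 ^ k) := by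
  have := blockStart_le k
  rw [blockStart]
  omega

lemma card_subBlock (k j : ℕ) : (subBlock k j).card = 4 ^ k := by
  rw [subBlock, Nat.card_Ico, add_mul, one_mul, ← add_assoc, Nat.add_sub_cancel_left]

lemma pairwise_disjoint_subBlock (k : ℕ) :
    Pairwise (Function.onFun Disjoint fun j => (subBlock k j : Set ℕ)) := by
  have h : Monotone fun j => blockStart k + j * 4 ^ k := fun a b hab => by
    dsimp only
    gcongr
  simpa [subBlock] using h.pairwise_disjoint_on_Ico_succ

lemma subBlock_subset {k j : ℕ} (hj : j < blockRate k) :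
    (subBlock k j : Set ℕ) ⊆ Set.Ico (blockStart k) (blockStart (k + 1)) := by
  rw [subBlock, Finset.coe_Ico, blockStart]
  refine Set.Ico_subset_Ico (Nat.le_add_right _ _) ?_
  gcongr
  exact hj

lemma measurable_partialSum_iSup_comap {Ω : Type*} (ε : ℕ → Ω → ℝ) {s : Finset ℕ} {B : Set ℕ}
    (hs : (s : Set ℕ) ⊆ B) :
    Measurable[⨆ i ∈ B, MeasurableSpace.comap (ε i) inferInstance] (partialSum ε s) := by
  refine Finset.measurable_fun_sum s fun i hi => ?_
  have h1 : MeasurableSpace.comap (ε i) inferInstance ≤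
      ⨆ i ∈ B, MeasurableSpace.comap (ε i) inferInstance :=
    le_iSup₂_of_le (f := fun i (_ : i ∈ B) => MeasurableSpace.comap (ε i) inferInstance)
      i (hs hi) le_rfl
  exact (comap_measurable (ε i)).mono h1 le_rfl

lemma measurableSet_blockEvent_iSup_comap {Ω : Type*} (ε : ℕ → Ω → ℝ) (k : ℕ) :
    MeasurableSet[⨆ i ∈ Set.Ico (blockStart k) (blockStart (k + 1)),
      MeasurableSpace.comap (ε i) inferInstance] (blockEvent ε k) :=
  Finset.measurableSet_biInter _ fun _ hj =>
    measurable_partialSum_iSup_comap ε (subBlock_subset (Finset.mem_range.1 hj)) measurableSet_Ioi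

lemma le_partialSum_sub_of_mem_blockEvent {Ω : Type*} {ε : ℕ → Ω → ℝ} {k : ℕ} {ω : Ω}
    (hω : ω ∈ blockEvent ε k) :
    blockRate k * (2 ^ k / 5) ≤ partialSum ε (Finset.range (blockStart (k + 1))) ω -
      partialSum ε (Finset.range (blockStart k)) ω := by
  have hω' : ∀ j < blockRate k, (2 : ℝ) ^ k / 5 < partialSum ε (subBlock k j) ω := by
    simpa [blockEvent] using hω
  have key : ∀ r ≤ blockRate k, r * ((2 : ℝ) ^ k / 5) ≤
      partialSum ε (Finset.range (blockStart k + r * 4 ^ k)) ω -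
        partialSum ε (Finset.range (blockStart k)) ω := by
    intro r
    induction r with
    | zero => simp
    | succ r ih =>
      intro hr
      have h1 := ih (Nat.le_of_succ_le hr)
      have h2 := hω' r hr
      have h3 : partialSum ε (subBlock k r) ω =
          partialSum ε (Finset.range (blockStart k + (r + 1) * 4 ^ k)) ω -
            partialSum ε (Finset.range (blockStart k + r * 4 ^ k)) ω :=
        Finset.sum_Ico_eq_sub _ (by gcongr; exact Nat.le_succ r)
      push_cast
      linarith
  exact key _ le_rfl

lemma log_log_add_three_pos {n : ℕ} (hn : 1 ≤ n) : 0 < Real.log (Real.log ((n : ℝ) + 3)) := by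
  have hn' : (1 : ℝ) ≤ n := by exact_mod_cast hn
  refine Real.log_pos ?_
  rw [Real.lt_log_iff_exp_lt (by linarith)]
  linarith [Real.exp_one_lt_d9]

/-- Crudely `n + 3 ≤ 8 ^ (k + 1)`, so `log (n + 3) ≤ 7 (k + 1) ≤ 7 * 24 ^ blockRate k`; a second
logarithm gives `6 + 23 * blockRate k`. -/
lemma log_log_add_three_le_blockRate {n k : ℕ} (hn : n ≤ 2 * (blockRate k * 4 ^ k)) :
    Real.log (Real.log ((n : ℝ) + 3)) ≤ 29 * blockRate k := by
  have hr : (1 : ℝ) ≤ blockRate k := by exact_mod_cast one_le_blockRate k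
  have h1 : n + 3 ≤ 8 ^ (k + 1) := by
    have h2 : blockRate k ≤ 2 ^ (k + 1) := (blockRate_le k).trans Nat.lt_two_pow_self
    have h3 : (8 : ℕ) ^ k = 2 ^ k * 4 ^ k := by rw [← mul_pow]; norm_num
    have h4 : 1 ≤ (8 : ℕ) ^ k := Nat.one_le_pow _ _ (by norm_num)
    have h5 := Nat.mul_le_mul_right (4 ^ k) h2
    rw [pow_succ] at h5 ⊢
    nlinarith
  have h2 : ((n : ℝ) + 3) ≤ 8 ^ (k + 1) := by exact_mod_cast h1
  have h3 : Real.log ((n : ℝ) + 3) ≤ 7 * 24 ^ blockRate k := by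
    have h4 := Real.log_le_log (by positivity) h2
    rw [Real.log_pow] at h4
    have h5 : Real.log 8 ≤ 7 := by
      linarith [Real.log_le_sub_one_of_pos (show (0 : ℝ) < 8 by norm_num)]
    have h6 : ((k + 1 : ℕ) : ℝ) ≤ 24 ^ blockRate k := by exact_mod_cast (lt_pow_blockRate k).le
    have h7 : ((k + 1 : ℕ) : ℝ) * Real.log 8 ≤ ((k + 1 : ℕ) : ℝ) * 7 := by gcongr
    linarith
  have hpos : 0 < Real.log ((n : ℝ) + 3) := Real.log_pos (by linarith [n.cast_nonneg (α := ℝ)])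
  refine (Real.log_le_log hpos h3).trans ?_
  rw [Real.log_mul (by norm_num) (by positivity), Real.log_pow]
  have h5 : Real.log 7 ≤ 6 := by
    linarith [Real.log_le_sub_one_of_pos (show (0 : ℝ) < 7 by norm_num)]
  have h6 : Real.log 24 ≤ 23 := by
    linarith [Real.log_le_sub_one_of_pos (show (0 : ℝ) < 24 by norm_num)]
  nlinarith

/-! ### Borel-Cantelli and the iterated logarithm. -/

namespace IsRademacherSeq

variable {Ω : Type*} [MeasurableSpace Ω] {P : Measure Ω} {ε : ℕ → Ω → ℝ}

lemma measurableSet_blockEvent (h : IsRademacherSeq ε P) (k : ℕ) :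
    MeasurableSet (blockEvent ε k) :=
  Finset.measurableSet_biInter _ fun _ _ => h.measurable_partialSum _ measurableSet_Ioi

variable [IsProbabilityMeasure P]

lemma le_measureReal_blockEvent (h : IsRademacherSeq ε P) (k : ℕ) :
    1 / (24 * ((k : ℝ) + 1)) ≤ P.real (blockEvent ε k) := by
  have hprod : P (blockEvent ε k) = ∏ j ∈ Finset.range (blockRate k),
      P {ω | 2 ^ k / 5 < partialSum ε (subBlock k j) ω} :=
    h.indep.iIndep.measure_biInter_of_disjoint (fun i => (h.measurable i).comap_le)
      ((pairwise_disjoint_subBlock k).set_pairwise _)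
      fun j _ => measurable_partialSum_iSup_comap ε subset_rfl measurableSet_Ioi
  have h1 : ∀ j ∈ Finset.range (blockRate k),
      (1 / 24 : ℝ) ≤ P.real {ω | 2 ^ k / 5 < partialSum ε (subBlock k j) ω} := fun j _ =>
    h.le_measureReal_partialSum (by positivity) (by
      rw [card_subBlock, ← pow_mul, mul_comm, pow_mul]; norm_num)
  have h2 := Finset.prod_le_prod (fun _ _ => by norm_num) h1
  rw [Finset.prod_const, Finset.card_range] at h2
  rw [Measure.real, hprod, ENNReal.toReal_prod]
  refine le_trans ?_ h2
  rw [one_div_pow]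
  refine one_div_le_one_div_of_le (by positivity) ?_
  exact_mod_cast pow_blockRate_le k

lemma ae_frequently_mem_blockEvent (h : IsRademacherSeq ε P) :
    ∀ᵐ ω ∂P, ∃ᶠ k in atTop, ω ∈ blockEvent ε k := by
  have hind : iIndepSet (blockEvent ε) P := by
    refine (iIndepSet_iff_meas_biInter h.measurableSet_blockEvent).2 fun s => ?_
    exact h.indep.iIndep.measure_biInter_of_disjoint (fun i => (h.measurable i).comap_le)
      (monotone_blockStart.pairwise_disjoint_on_Ico_succ.set_pairwise _)
      fun k _ => measurableSet_blockEvent_iSup_comap ε k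
  have hsum : ∑' k, P (blockEvent ε k) = ⊤ := by
    by_contra hne
    -- A finite sum would make the harmonic series converge.
    have h1 : Summable fun k => P.real (blockEvent ε k) := ENNReal.summable_toReal hne
    have h2 : Summable fun k : ℕ => 1 / (24 * ((k : ℝ) + 1)) :=
      h1.of_nonneg_of_le (fun k => by positivity) h.le_measureReal_blockEvent
    refine Real.not_summable_one_div_natCast ((summable_nat_add_iff 1).1 ?_)
    refine (h2.mul_left 24).congr fun k => ?_
    push_cast
    field_simp
  have h1 := measure_limsup_eq_one h.measurableSet_blockEvent hind hsum
  have h2 := (mem_ae_iff_prob_eq_one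
    (MeasurableSet.measurableSet_limsup h.measurableSet_blockEvent)).2 h1
  filter_upwards [h2] with ω hω
  exact mem_limsup_iff_frequently_mem.1 hω

/-- The lower half of the law of the iterated logarithm, up to a constant factor. -/
lemma ae_frequently_le_rademacherChaos_div (h : IsRademacherSeq ε P) :
    ∀ᵐ ω ∂P, ∃ᶠ n : ℕ in atTop, (1 / 23200 : ℝ) ≤
      rademacherChaos ε n ω / ((n : ℝ) * Real.log (Real.log ((n : ℝ) + 3))) := by
  filter_upwards [h.ae_frequently_mem_blockEvent, h.ae_rademacherChaos_eq] with ω hω hξ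
  rw [frequently_atTop]
  intro N
  obtain ⟨k, hk, hkN, hkr⟩ := (hω.and_eventually
    ((eventually_ge_atTop (N + 1)).and (eventually_le_blockRate 400))).exists
  have hd := le_partialSum_sub_of_mem_blockEvent hk
  have hr : (400 : ℝ) ≤ blockRate k := by exact_mod_cast hkr
  have hle : ∀ n : ℕ, blockStart k ≤ n → n ≤ blockStart (k + 1) →
      (blockRate k * (2 ^ k / 10) : ℝ) ^ 2 ≤ partialSum ε (Finset.range n) ω ^ 2 →
      N ≤ n ∧ (1 / 23200 : ℝ) ≤
        rademacherChaos ε n ω / ((n : ℝ) * Real.log (Real.log ((n : ℝ) + 3))) := by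
    intro n hn1 hn2 hS
    have hn : N + 1 ≤ n := hkN.trans ((le_blockStart k).trans hn1)
    have hn3 := hn2.trans (blockStart_succ_le k)
    have hn0 : (1 : ℝ) ≤ n := by exact_mod_cast (Nat.le_add_left 1 N).trans hn
    have hL := log_log_add_three_pos ((Nat.le_add_left 1 N).trans hn)
    have hL2 := log_log_add_three_le_blockRate hn3
    have hn4 : (n : ℝ) ≤ 2 * (blockRate k * 4 ^ k) := by exact_mod_cast hn3
    refine ⟨(Nat.le_succ N).trans hn, ?_⟩
    rw [hξ n, le_div_iff₀ (by positivity)]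
    have e : (blockRate k * (2 ^ k / 10) : ℝ) ^ 2 =
        blockRate k * (blockRate k * 4 ^ k) / 100 := by
      rw [show (4 : ℝ) = 2 ^ 2 by norm_num, ← pow_mul, mul_comm 2 k, pow_mul]
      ring
    rw [e] at hS
    set L := (n : ℝ) * Real.log (Real.log ((n : ℝ) + 3))
    -- Write `r = blockRate k`. Then `S ^ 2 ≥ r n / 200`, and `r ≥ 400` gives `n ≤ r n / 400`, so `ξ
    -- ≥ r n / 800`. With `L ≤ 29 r n` the constant is `800 * 29 = 23200`.
    have h1 : (blockRate k : ℝ) * n ≤ blockRate k * (2 * (blockRate k * 4 ^ k)) := by gcongr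
    have h2 : L ≤ n * (29 * blockRate k) :=
      mul_le_mul_of_nonneg_left hL2 (by positivity)
    have h3 : 400 * (n : ℝ) ≤ blockRate k * n := by gcongr
    clear_value L
    linarith
  set a := partialSum ε (Finset.range (blockStart k)) ω
  set b := partialSum ε (Finset.range (blockStart (k + 1))) ω
  have hpos : (0 : ℝ) ≤ blockRate k * (2 ^ k / 10) := by positivity
  -- As `b - a ≥ r * 2 ^ k / 5`, either `b` or `-a` is at least half of that.
  rcases le_or_gt (blockRate k * (2 ^ k / 10) : ℝ) b with hb | hb
  · exact ⟨_, hle _ (monotone_blockStart (Nat.le_succ k)) le_rfl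
      (pow_le_pow_left₀ hpos hb 2)⟩
  · refine ⟨_, hle _ le_rfl (monotone_blockStart (Nat.le_succ k)) ?_⟩
    have ha : (blockRate k * (2 ^ k / 10) : ℝ) ≤ -a := by linarith
    rw [← neg_sq (partialSum _ _ _)]
    exact pow_le_pow_left₀ hpos ha 2

lemma ae_limsup_rademacherChaos_div_pos (h : IsRademacherSeq ε P) :
    ∀ᵐ ω ∂P, 0 < limsup (fun n : ℕ =>
      ((rademacherChaos ε n ω / ((n : ℝ) * Real.log (Real.log ((n : ℝ) + 3))) : ℝ) : EReal))
        atTop := by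
  filter_upwards [h.ae_frequently_le_rademacherChaos_div] with ω hω
  refine lt_of_lt_of_le (b := ((1 / 23200 : ℝ) : EReal)) ?_
    (le_limsup_of_frequently_le (hω.mono fun n hn => EReal.coe_le_coe_iff.2 hn))
  exact EReal.coe_pos.2 (by norm_num)

lemma ae_forall_exists_lt_rademacherChaos_div (h : IsRademacherSeq ε P) {w : ℕ → ℝ}
    (hw : ∀ n, 0 < w n)
    (hwo : w =o[atTop] (fun n : ℕ => Real.log (Real.log ((n : ℝ) + 3)))) :
    ∀ᵐ ω ∂P, ∀ u : ℝ, ∃ n : ℕ, 1 ≤ n ∧ u < rademacherChaos ε n ω / ((n : ℝ) * w n) := by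
  filter_upwards [h.ae_frequently_le_rademacherChaos_div] with ω hω u
  have hu : 0 < |u| + 1 := by positivity
  -- The threshold for `w` makes the quotient at least `|u| + 1` whenever the iterated-logarithm
  -- bound holds.
  obtain ⟨n, hn, hwn, hn1⟩ := (hω.and_eventually ((hwo.bound
    (show (0 : ℝ) < 1 / 23200 / (|u| + 1) by positivity)).and (eventually_ge_atTop 1))).exists
  have hL := log_log_add_three_pos hn1
  have hn0 : (0 : ℝ) < n := by exact_mod_cast hn1
  have hw0 := hw n
  refine ⟨n, hn1, ?_⟩
  rw [Real.norm_of_nonneg hw0.le, Real.norm_of_nonneg hL.le, div_mul_eq_mul_div,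
    le_div_iff₀ hu] at hwn
  rw [le_div_iff₀ (by positivity)] at hn
  rw [lt_div_iff₀ (by positivity)]
  calc u * (n * w n) < (|u| + 1) * (n * w n) := by
        have := le_abs_self u
        gcongr
        linarith
    _ = n * (w n * (|u| + 1)) := by ring
    _ ≤ n * (1 / 23200 * Real.log (Real.log ((n : ℝ) + 3))) := by gcongr
    _ = 1 / 23200 * (n * Real.log (Real.log ((n : ℝ) + 3))) := by ring
    _ ≤ _ := hn

end IsRademacherSeq

lemma MeasureTheory.measure_setOf_pos_of_ae {Ω : Type*} [MeasurableSpace Ω] {P : Measure Ω}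
    [IsProbabilityMeasure P] {p : Ω → Prop} (h : ∀ᵐ ω ∂P, p ω) : 0 < P {ω | p ω} := by
  have h1 : P {ω | p ω} = P Set.univ := measure_congr (eventuallyEq_univ.2 h)
  rw [h1, measure_univ]
  exact one_pos

theorem mainTheorem4 {Ω : Type*} [MeasurableSpace Ω] (P : Measure Ω) [IsProbabilityMeasure P]
    (ε : ℕ → Ω → ℝ) (hε : IsRademacherSeq ε P) :
    -- the upper limit is positive with positive probability
    0 < P {ω | 0 < limsup (fun n : ℕ =>
        ((rademacherChaos ε n ω / ((n : ℝ) * Real.log (Real.log ((n : ℝ) + 3))) : ℝ) : EReal))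
        atTop} ∧
    -- `ξ` belongs to the class of martingales in question, with `r = 1` and `σ(n) = n`
    Martingale (rademacherChaos ε) (firstTermsFiltration ε hε.measurable) P ∧
    (∃ c₁ c₂ : ℝ, 0 < c₁ ∧ ∀ n : ℕ, 2 ≤ n →
        c₁ ≤ Var[rademacherChaos ε n; P] / (n : ℝ) ^ 2 ∧
        Var[rademacherChaos ε n; P] / (n : ℝ) ^ 2 ≤ c₂) ∧
    (∃ (l₀ : EReal) (φ : ℝ → ℝ), IsPhiFunction l₀ φ ∧
        Tendsto (fun x : ℝ => youngFenchel l₀ φ x / x) atTop (𝓝 1) ∧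
        ∀ n : ℕ, 1 ≤ n → ∀ x : ℝ, 0 ≤ x →
          tailU P (fun ω => rademacherChaos ε n ω / (n : ℝ)) x
            ≤ Real.exp (-youngFenchel l₀ φ x)) ∧
    -- the factor `log log (n + 3)` cannot be replaced by one of smaller order
    (∀ w : ℕ → ℝ, (∀ n, 0 < w n) →
        w =o[atTop] (fun n : ℕ => Real.log (Real.log ((n : ℝ) + 3))) →
        0 < P {ω | ∀ u : ℝ, ∃ n : ℕ, 1 ≤ n ∧ u < rademacherChaos ε n ω / ((n : ℝ) * w n)}) := by
  exact ⟨measure_setOf_pos_of_ae hε.ae_limsup_rademacherChaos_div_pos,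
    hε.martingale_rademacherChaos,
    ⟨1 / 4, 1 / 2, by norm_num, fun _ hn => hε.variance_rademacherChaos_div_bounds hn⟩,
    ⟨1, halfNegLog, isPhiFunction_halfNegLog, tendsto_youngFenchel_halfNegLog_div,
      fun _ hn _ hx => hε.tailU_rademacherChaos_div_le_exp_youngFenchel hn hx⟩,
    fun _ hw hwo => measure_setOf_pos_of_ae (hε.ae_forall_exists_lt_rademacherChaos_div hw hwo)⟩
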